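/- **Setting.** Wealth takes values in $[0,\infty)$. A *state* is a probability measure on $[0,\infty)$; its *mean wealth* is $\langle x\rangle_\mu=\int x\,d\mu$. A *rule of unbiased binary exchanges* assigns to every $(x,x')\in[0,\infty)^2$ a probability measure $\omega_{x,x'}$ on $\mathbb{R}$ (the law of the gain $\Delta$ of an agent of wealth $x$ who meets an agent of wealth $x'$, so that $[x,x']\to[x+\Delta,x'-\Delta]$), concentrated on $[-x,x']$, depending measurably and weakly continuously on $(x,x')$, with $\int\Delta\,\omega_{x,x'}(d\Delta)=0$ for all $x,x'$. An *evolution* of mean $m>0$ is a family of states $(\mu_t)_{t\ge0}$ with $\int x\,d\mu_t=m$ for all $t$ that solves the master equation in weak form: for every bounded continuous $\varphi$ and every $t\ge 0$ (one-sided derivative at $t=0$), $$\frac{d}{dt}\int\varphi\,d\mu_t=\iiint\big(\varphi(x+\Delta)-\varphi(x)\big)\,\omega_{x,x'}(d\Delta)\,\mu_t(dx')\,\mu_t(dx).$$ For a state $\mu$ of finite positive mean put $$l_\mu(x)=\iint|\Delta|\,\omega_{x,x'}(d\Delta)\,\mu(dx'),\qquad L(\mu)=\frac1{2\langle x\rangle_\mu}\int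 l_\mu\,d\mu,\qquad G(\mu)=\frac1{2\langle x\rangle_\mu}\iint|x-x_1|\,\mu(dx_1)\,\mu(dx)$$ (mobility, liquidity, Gini index); the mobility $l_\mu$ is defined by the same formula for every state of finite mean. A wealth $x$ is *absorbing* in the state $\mu$ if it is occupied, $x\in\operatorname{supp}\mu$, and $l_\mu(x)=0$. That *$0$ is the unique absorbing state of the system* means that in every state $\mu$ of finite mean no $x>0$ is absorbing. (Always $l_\mu(0)=0$ for an unbiased rule.) **Proposition 3.** Consider a rule of unbiased binary exchanges for which $x=0$ is the unique absorbing state, and an evolution $(\mu_t)_{t\ge 0}$ of mean $m>0$. Then, as $t\to\infty$: (i) $\mu_t$ converges to the absolute oligarchy $f_c=\delta(x)+\lim_{N\to\infty}\delta(x-mN)/N$. That is, $\mu_t\to\delta_0$ weakly; for every continuous $\varphi:[0,\infty)\to\mathbb{R}$ such that $\varphi(x)/x$ has a finite limit as $x\to\infty$, $\int\varphi\,d\mu_t\to\varphi(0)+\lim_{N\to\infty}\varphi(mN)/N$; for every $R\ge0$, $\int_{(R,\infty)}x\,d\mu_t\to m$; and for every real $k>1$, $\int x^k\,d\mu_t\to\infty$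 (as elements of $[0,\infty]$). (ii) $G(\mu_t)\to1$. (iii) $L(\mu_t)\to0$. -/

import Mathlib

open MeasureTheory ProbabilityTheory Filter Topology
open scoped NNReal ENNReal BoundedContinuousFunction

noncomputable section

/-! Wealth takes values in `ℝ≥0`.  A state of the system is a probability measure on `ℝ≥0`
(the measure `f(x,t) dx`, which may have atoms).  An exchange rule is a Markov kernel `K`:
`K (x, x')` is the law `ω_{[x,x'] → [x+Δ,x'-Δ]} dΔ` of the gain `Δ` of an agent of wealth `x`
who meets an agent of wealth `x'`; being Markov is the normalization of the transfer rates. -/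

/-- The gain of an agent is at least `-x` and at most `x'`, so no wealth becomes negative. -/
def KeepsWealthNonneg (K : Kernel (ℝ≥0 × ℝ≥0) ℝ) : Prop :=
  ∀ x x' : ℝ≥0, ∀ᵐ Δ ∂(K (x, x')), -(x : ℝ) ≤ Δ ∧ Δ ≤ (x' : ℝ)

/-- The expected gain is zero in every meeting. -/
def IsUnbiased (K : Kernel (ℝ≥0 × ℝ≥0) ℝ) : Prop :=
  ∀ x x' : ℝ≥0, ∫ Δ, Δ ∂(K (x, x')) = 0

/-- The law of the gain depends continuously (for weak convergence of measures) on the wealths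
of the two agents. -/
def IsContinuousRule (K : Kernel (ℝ≥0 × ℝ≥0) ℝ) : Prop :=
  ∀ φ : ℝ →ᵇ ℝ, Continuous fun p : ℝ≥0 × ℝ≥0 => ∫ Δ, φ Δ ∂(K p)

/-- The state has finite mean wealth. -/
def HasFiniteMean (μ : ProbabilityMeasure ℝ≥0) : Prop :=
  Integrable (fun x : ℝ≥0 => (x : ℝ)) (μ : Measure ℝ≥0)

/-- The mean wealth `⟨x⟩`. -/
def meanWealth (μ : ProbabilityMeasure ℝ≥0) : ℝ :=
  ∫ x, (x : ℝ) ∂(μ : Measure ℝ≥0)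

/-- The master equation on `[0, ∞)`, in weak form: tested with every bounded continuous `φ`,
`d/dt ∫ φ dμ_t` is the gain term minus the loss term. -/
def SolvesMasterEquation (K : Kernel (ℝ≥0 × ℝ≥0) ℝ) (μ : ℝ → ProbabilityMeasure ℝ≥0) : Prop :=
  ∀ φ : ℝ →ᵇ ℝ, ∀ t : ℝ, 0 ≤ t →
    HasDerivWithinAt (fun s => ∫ x, φ (x : ℝ) ∂(μ s : Measure ℝ≥0))
      (∫ x, ∫ x', ∫ Δ, (φ ((x : ℝ) + Δ) - φ (x : ℝ)) ∂(K (x, x'))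
        ∂(μ t : Measure ℝ≥0) ∂(μ t : Measure ℝ≥0))
      (Set.Ici 0) t

/-- An evolution `(μ_t)`, `t ≥ 0`, of the system: wealth distributions with constant mean `m`
which solve the master equation. -/
structure IsEvolution (K : Kernel (ℝ≥0 × ℝ≥0) ℝ) (m : ℝ)
    (μ : ℝ → ProbabilityMeasure ℝ≥0) : Prop where
  finite_mean : ∀ t : ℝ, 0 ≤ t → HasFiniteMean (μ t)
  mean_eq : ∀ t : ℝ, 0 ≤ t → meanWealth (μ t) = m
  master : SolvesMasterEquation K μ

/-- The Gini index of a state. -/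
def giniIndex (μ : ProbabilityMeasure ℝ≥0) : ℝ :=
  1 / (2 * meanWealth μ) *
    ∫ x, ∫ x₁, |(x : ℝ) - (x₁ : ℝ)| ∂(μ : Measure ℝ≥0) ∂(μ : Measure ℝ≥0)

/-- The mobility `l(x)` of agents of wealth `x` in the state `μ`. -/
def mobility (K : Kernel (ℝ≥0 × ℝ≥0) ℝ) (μ : ProbabilityMeasure ℝ≥0) (x : ℝ≥0) : ℝ :=
  ∫ x', ∫ Δ, |Δ| ∂(K (x, x')) ∂(μ : Measure ℝ≥0)

/-- The liquidity of a state. -/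
def liquidity (K : Kernel (ℝ≥0 × ℝ≥0) ℝ) (μ : ProbabilityMeasure ℝ≥0) : ℝ :=
  1 / (2 * meanWealth μ) * ∫ x, mobility K μ x ∂(μ : Measure ℝ≥0)

/-- In the state `μ` the wealth `x` is occupied (it lies in the support of `μ`) and agents of
wealth `x` have zero mobility. -/
def IsAbsorbingIn (K : Kernel (ℝ≥0 × ℝ≥0) ℝ) (μ : ProbabilityMeasure ℝ≥0) (x : ℝ≥0) : Prop :=
  x ∈ (μ : Measure ℝ≥0).support ∧ mobility K μ x = 0

/-- No wealth other than `0` is absorbing, in any state of finite mean.  (For an unbiased rule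
`mobility K μ 0 = 0` always holds, so it is not asked for here.) -/
def ZeroIsUniqueAbsorbing (K : Kernel (ℝ≥0 × ℝ≥0) ℝ) : Prop :=
  ∀ μ : ProbabilityMeasure ℝ≥0, HasFiniteMean μ → ∀ x : ℝ≥0, IsAbsorbingIn K μ x → x = 0

/-- Convergence, as `t → ∞`, to the absolute oligarchy
`f_c = δ(x) + lim_{N → ∞} δ(x - m N) / N` of mean wealth `m`. -/
structure TendsToAbsoluteOligarchy (m : ℝ≥0) (μ : ℝ → ProbabilityMeasure ℝ≥0) : Prop where
  /-- Weak convergence of the probability measures to the point mass at `0`. -/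
  tendsto_dirac :
    Tendsto μ atTop (𝓝 (⟨Measure.dirac 0, inferInstance⟩ : ProbabilityMeasure ℝ≥0))
  /-- `∫ φ dμ_t` tends to `⟨f_c, φ⟩ = φ(0) + lim_N φ(m N) / N` for every continuous test function
  that is asymptotically linear. -/
  tendsto_pairing : ∀ φ : ℝ≥0 → ℝ, Continuous φ → ∀ c v : ℝ,
    Tendsto (fun x : ℝ≥0 => φ x / (x : ℝ)) atTop (𝓝 c) →
    Tendsto (fun N : ℕ => φ 0 + φ (m * (N : ℝ≥0)) / (N : ℝ)) atTop (𝓝 v) →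
    Tendsto (fun t : ℝ => ∫ x, φ x ∂(μ t : Measure ℝ≥0)) atTop (𝓝 v)
  /-- All the wealth escapes to infinity. -/
  wealth_escapes : ∀ R : ℝ≥0,
    Tendsto (fun t : ℝ => ∫ x in Set.Ioi R, (x : ℝ) ∂(μ t : Measure ℝ≥0)) atTop (𝓝 (m : ℝ))
  /-- The moments of order greater than one diverge. -/
  moments_diverge : ∀ k : ℝ, 1 < k →
    Tendsto (fun t : ℝ => ∫⁻ x, (x : ℝ≥0∞) ^ k ∂(μ t : Measure ℝ≥0)) atTop (𝓝 ⊤)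

end

/-!
The bounded convex function `exp (-x)` provides a Lyapunov functional: since gains have mean zero,
Jensen's inequality shows that `∫ exp (-x) dμ_t` is nondecreasing, at a rate (the `dissipation` of
`μ_t`) that vanishes only if almost no meeting moves any wealth. A state without dissipation
therefore has zero mobility at almost every wealth, and since `0` is the only absorbing wealth such
a state is the point mass at `0` (`ae_eq_zero_of_dissipation_eq_zero`).

The states of mean at most `m` form a weakly compact set by Prokhorov's theorem
(`isCompact_statesOfMeanLE`), on which the dissipation is continuous. So as long as the functional
stays below `1 - ε` it grows at a rate bounded below, which is impossible forever because it is at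
most `1`. Hence it tends to `1` (`tendsto_expMean`); no rate of convergence is involved.

Any continuous function that vanishes at `0` and is sublinear at infinity is bounded by
`ε * (1 + x) + C * (1 - exp (-x))` (`exists_abs_le_of_sublinear`), so its integral against `μ_t`
tends to `0`; the mean being conserved, this gives all forms of convergence to the absolute
oligarchy. The Gini index equals `1 - m⁻¹ ∬ min x y`, and the liquidity is at most
`m⁻¹ ∬ min x y` because an unbiased gain has mean absolute value at most `2 * min x x'`; the double
integral tends to `0` (`tendsto_integral_min_prod`).
-/

/-! ### Gains of a single meeting -/

variable {K : Kernel (ℝ≥0 × ℝ≥0) ℝ}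

/-- The expected increment of `exp (-x)` over one meeting of agents of wealths `p.1` and `p.2`,
seen by the first of them; the factor `exp (-x)` is taken out of the expectation. -/
noncomputable def expIncrement (K : Kernel (ℝ≥0 × ℝ≥0) ℝ) (p : ℝ≥0 × ℝ≥0) : ℝ :=
  Real.exp (-(p.1 : ℝ)) * (∫ Δ, Real.exp (-Δ) ∂(K p) - 1)

lemma continuous_expIncrement (hK : KeepsWealthNonneg K) (hcont : IsContinuousRule K) :
    Continuous (expIncrement K) := by
  rw [continuous_iff_continuousAt]
  intro p
  -- Near `p` losses are bounded by `M`, so `exp (-Δ)` may be truncated to a bounded function.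
  set M : ℝ := p.1 + 1
  let ψ : ℝ →ᵇ ℝ := BoundedContinuousFunction.ofNormedAddCommGroup
    (fun Δ => min (Real.exp (-Δ)) (Real.exp M)) (by fun_prop) (Real.exp M) (fun Δ => by
      rw [Real.norm_eq_abs, abs_of_nonneg (le_min (Real.exp_pos _).le (Real.exp_pos _).le)]
      exact min_le_right _ _)
  have hψ : Continuous fun q : ℝ≥0 × ℝ≥0 =>
      Real.exp (-(q.1 : ℝ)) * (∫ Δ, ψ Δ ∂(K q) - 1) := by
    have := hcont ψ
    fun_prop
  refine hψ.continuousAt.congr ?_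
  have hnear : ∀ᶠ q : ℝ≥0 × ℝ≥0 in 𝓝 p, (q.1 : ℝ) < M := by
    have hc : Continuous fun q : ℝ≥0 × ℝ≥0 => (q.1 : ℝ) := by fun_prop
    exact hc.continuousAt.eventually_lt_const (by simp [M])
  filter_upwards [hnear] with q hq
  rw [expIncrement]
  congr 2
  refine integral_congr_ae ?_
  filter_upwards [hK q.1 q.2] with Δ hΔ
  exact min_eq_left (Real.exp_le_exp.2 (by linarith [hΔ.1]))

variable [IsMarkovKernel K]

lemma KeepsWealthNonneg.integrable_gain (hK : KeepsWealthNonneg K) (p : ℝ≥0 × ℝ≥0) :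
    Integrable (fun Δ : ℝ => Δ) (K p) := by
  refine Integrable.of_bound measurable_id.aestronglyMeasurable ((p.1 : ℝ) + p.2) ?_
  filter_upwards [hK p.1 p.2] with Δ hΔ
  have h1 := p.1.coe_nonneg
  have h2 := p.2.coe_nonneg
  rw [Real.norm_eq_abs, abs_le]
  constructor <;> linarith [hΔ.1, hΔ.2]

lemma KeepsWealthNonneg.integrable_exp_neg_gain (hK : KeepsWealthNonneg K) (p : ℝ≥0 × ℝ≥0) :
    Integrable (fun Δ : ℝ => Real.exp (-Δ)) (K p) := by
  refine Integrable.of_bound (by fun_prop) (Real.exp p.1) ?_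
  filter_upwards [hK p.1 p.2] with Δ hΔ
  rw [Real.norm_eq_abs, abs_of_pos (Real.exp_pos _)]
  exact Real.exp_le_exp.2 (by linarith [hΔ.1])

/-- Since the gain has mean zero, its positive and negative parts have the same mean; these parts
are at most `x'` and `x` respectively. -/
lemma integral_abs_gain_le (hK : KeepsWealthNonneg K) (hunb : IsUnbiased K) (x x' : ℝ≥0) :
    ∫ Δ, |Δ| ∂(K (x, x')) ≤ 2 * min (x : ℝ) x' := by
  have hint := hK.integrable_gain (x, x')
  have h0 := hunb x x'
  rw [mul_min_of_nonneg _ _ zero_le_two]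
  refine le_min ?_ ?_
  · have h : ∫ Δ, |Δ| ∂(K (x, x')) ≤ ∫ Δ, (Δ + 2 * x) ∂(K (x, x')) := by
      refine integral_mono_ae hint.abs (hint.add (integrable_const _)) ?_
      filter_upwards [hK x x'] with Δ hΔ
      have := x.coe_nonneg
      exact abs_le.2 ⟨by linarith [hΔ.1], by linarith⟩
    rwa [integral_add hint (integrable_const _), h0, integral_const, probReal_univ, zero_add,
      one_smul] at h
  · have h : ∫ Δ, |Δ| ∂(K (x, x')) ≤ ∫ Δ, (2 * x' - Δ) ∂(K (x, x')) := by
      refine integral_mono_ae hint.abs ((integrable_const _).sub hint) ?_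
      filter_upwards [hK x x'] with Δ hΔ
      have := x'.coe_nonneg
      exact abs_le.2 ⟨by linarith, by linarith [hΔ.2]⟩
    rwa [integral_sub (integrable_const _) hint, h0, integral_const, probReal_univ, sub_zero,
      one_smul] at h

lemma integral_exp_neg_gain_sub_one (hK : KeepsWealthNonneg K) (hunb : IsUnbiased K)
    (p : ℝ≥0 × ℝ≥0) :
    ∫ Δ, Real.exp (-Δ) ∂(K p) - 1 = ∫ Δ, (Real.exp (-Δ) - (-Δ + 1)) ∂(K p) := by
  have hint := hK.integrable_gain p
  have h0 : ∫ Δ, Δ ∂(K p) = 0 := hunb p.1 p.2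
  have hneg : Integrable (fun Δ : ℝ => -Δ) (K p) := hint.neg
  have hlin : Integrable (fun Δ : ℝ => -Δ + 1) (K p) := hneg.add (integrable_const _)
  rw [integral_sub (hK.integrable_exp_neg_gain p) hlin, integral_add hneg (integrable_const _)]
  rw [integral_neg, h0]
  simp

lemma expIncrement_nonneg (hK : KeepsWealthNonneg K) (hunb : IsUnbiased K) (p : ℝ≥0 × ℝ≥0) :
    0 ≤ expIncrement K p := by
  rw [expIncrement, integral_exp_neg_gain_sub_one hK hunb]
  exact mul_nonneg (Real.exp_pos _).le
    (integral_nonneg fun Δ => sub_nonneg.2 (Real.add_one_le_exp _))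

/-- The equality case of Jensen's inequality for `exp`, which is strictly convex. -/
lemma integral_abs_gain_eq_zero (hK : KeepsWealthNonneg K) (hunb : IsUnbiased K)
    {p : ℝ≥0 × ℝ≥0} (hp : expIncrement K p = 0) : ∫ Δ, |Δ| ∂(K p) = 0 := by
  rw [expIncrement, integral_exp_neg_gain_sub_one hK hunb] at hp
  have h := (mul_eq_zero.1 hp).resolve_left (Real.exp_pos _).ne'
  rw [integral_eq_zero_iff_of_nonneg (fun Δ => sub_nonneg.2 (Real.add_one_le_exp _))
    ((hK.integrable_exp_neg_gain p).sub
      ((hK.integrable_gain p).neg.add (integrable_const _)))] at h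
  refine integral_eq_zero_of_ae ?_
  filter_upwards [h] with Δ hΔ
  by_contra hne
  have hlt := Real.add_one_lt_exp (x := -Δ) (by simpa using hne)
  simp only [Pi.zero_apply] at hΔ
  linarith

lemma abs_expIncrement_le_one (hK : KeepsWealthNonneg K) (hunb : IsUnbiased K) (p : ℝ≥0 × ℝ≥0) :
    |expIncrement K p| ≤ 1 := by
  rw [abs_of_nonneg (expIncrement_nonneg hK hunb p), expIncrement]
  have h : ∫ Δ, Real.exp (-Δ) ∂(K p) ≤ Real.exp p.1 := by
    have := integral_mono_ae (hK.integrable_exp_neg_gain p)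
      (integrable_const (μ := K p) (Real.exp p.1)) (by
        filter_upwards [hK p.1 p.2] with Δ hΔ
        exact Real.exp_le_exp.2 (by linarith [hΔ.1]))
    simpa using this
  calc Real.exp (-(p.1 : ℝ)) * (∫ Δ, Real.exp (-Δ) ∂(K p) - 1)
      ≤ Real.exp (-(p.1 : ℝ)) * Real.exp p.1 := by gcongr; linarith
    _ = 1 := by rw [← Real.exp_add]; simp

/-! ### The dissipation of a state -/

/-- The rate at which `∫ exp (-x) dν` grows under the master equation. -/
noncomputable def dissipation (K : Kernel (ℝ≥0 × ℝ≥0) ℝ) (ν : ProbabilityMeasure ℝ≥0) : ℝ :=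
  ∫ p, expIncrement K p ∂((ν : Measure ℝ≥0).prod (ν : Measure ℝ≥0))

lemma dissipation_nonneg (hK : KeepsWealthNonneg K) (hunb : IsUnbiased K)
    (ν : ProbabilityMeasure ℝ≥0) : 0 ≤ dissipation K ν :=
  integral_nonneg fun p => expIncrement_nonneg hK hunb p

lemma integrable_expIncrement (hK : KeepsWealthNonneg K) (hcont : IsContinuousRule K)
    (hunb : IsUnbiased K) (ρ : Measure (ℝ≥0 × ℝ≥0)) [IsProbabilityMeasure ρ] :
    Integrable (expIncrement K) ρ :=
  Integrable.of_bound (continuous_expIncrement hK hcont).aestronglyMeasurable 1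
    (.of_forall fun p => abs_expIncrement_le_one hK hunb p)

lemma continuous_dissipation (hK : KeepsWealthNonneg K) (hcont : IsContinuousRule K)
    (hunb : IsUnbiased K) : Continuous (dissipation K) := by
  let g : ℝ≥0 × ℝ≥0 →ᵇ ℝ := BoundedContinuousFunction.ofNormedAddCommGroup (expIncrement K)
    (continuous_expIncrement hK hcont) 1 (fun p => abs_expIncrement_le_one hK hunb p)
  have h := (ProbabilityMeasure.continuous_integral_boundedContinuousFunction g).comp
    ((ProbabilityMeasure.continuous_prod (α := ℝ≥0) (β := ℝ≥0)).comp
      (continuous_id.prodMk continuous_id))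
  exact h

/-- A state without dissipation has zero mobility almost everywhere, so all its agents sit at
absorbing wealths. -/
lemma ae_eq_zero_of_dissipation_eq_zero (hK : KeepsWealthNonneg K) (hcont : IsContinuousRule K)
    (hunb : IsUnbiased K) (habs : ZeroIsUniqueAbsorbing K) {ν : ProbabilityMeasure ℝ≥0}
    (hν : HasFiniteMean ν) (hD : dissipation K ν = 0) : ∀ᵐ x ∂(ν : Measure ℝ≥0), x = 0 := by
  have h0 := (integral_eq_zero_iff_of_nonneg (fun p => expIncrement_nonneg hK hunb p)
    (integrable_expIncrement hK hcont hunb _)).1 hD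
  have hmob : ∀ᵐ x ∂(ν : Measure ℝ≥0), mobility K ν x = 0 := by
    filter_upwards [Measure.ae_ae_of_ae_prod h0] with x hx
    refine integral_eq_zero_of_ae ?_
    filter_upwards [hx] with x' hx'
    exact integral_abs_gain_eq_zero hK hunb hx'
  filter_upwards [hmob, Measure.support_mem_ae (μ := (ν : Measure ℝ≥0))] with x hx hsupp
  exact habs ν hν x ⟨hsupp, hx⟩

/-! ### Compactness of the states of bounded mean -/

/-- The states of mean at most `m`. The bound is imposed on all truncations `min x n`, which are
bounded continuous test functions, so that it visibly passes to weak limits. -/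
def statesOfMeanLE (m : ℝ≥0) : Set (ProbabilityMeasure ℝ≥0) :=
  {ν | ∀ n : ℕ, ∫⁻ x, (min x (n : ℝ≥0) : ℝ≥0) ∂(ν : Measure ℝ≥0) ≤ m}

lemma isClosed_statesOfMeanLE (m : ℝ≥0) : IsClosed (statesOfMeanLE m) := by
  rw [statesOfMeanLE, Set.ofPred_forall]
  refine isClosed_iInter fun n => ?_
  let f : ℝ≥0 →ᵇ ℝ≥0 := BoundedContinuousFunction.mkOfBound
    ⟨fun x => min x (n : ℝ≥0), by fun_prop⟩ n (fun x y => by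
      rw [NNReal.dist_eq, abs_le]
      have h1 : (min x n : ℝ≥0) ≤ (n : ℝ) := by exact_mod_cast min_le_right x (n : ℝ≥0)
      have h2 : (min y n : ℝ≥0) ≤ (n : ℝ) := by exact_mod_cast min_le_right y (n : ℝ≥0)
      have h3 := (min x (n : ℝ≥0)).coe_nonneg
      have h4 := (min y (n : ℝ≥0)).coe_nonneg
      constructor <;> simp only [ContinuousMap.coe_mk] <;> linarith)
  exact isClosed_le
    (ProbabilityMeasure.continuous_lintegral_boundedContinuousFunction f) continuous_const

lemma isCompact_statesOfMeanLE (m : ℝ≥0) : IsCompact (statesOfMeanLE m) := by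
  rw [← (isClosed_statesOfMeanLE m).closure_eq]
  refine isCompact_closure_of_isTightMeasureSet ?_
  rw [isTightMeasureSet_iff_exists_isCompact_measure_compl_le]
  intro ε hε
  obtain ⟨n, hn⟩ := ENNReal.exists_nat_mul_gt (a := ε) (b := (m : ℝ≥0∞)) hε.ne' ENNReal.coe_ne_top
  refine ⟨Set.Icc 0 n, isCompact_Icc, ?_⟩
  rintro _ ⟨ν, hν, rfl⟩
  have hn0 : (n : ℝ≥0∞) ≠ 0 := by
    rintro h
    simp [h] at hn
  -- Markov's inequality for the truncation `min x n`.
  have hmarkov := mul_meas_ge_le_lintegral (μ := (ν : Measure ℝ≥0))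
    (f := fun x => ((min x (n : ℝ≥0) : ℝ≥0) : ℝ≥0∞)) (by fun_prop) n
  have hsub : (Set.Icc (0 : ℝ≥0) n)ᶜ ⊆
      {x | (n : ℝ≥0∞) ≤ ((min x (n : ℝ≥0) : ℝ≥0) : ℝ≥0∞)} := by
    intro x hx
    have hx' : (n : ℝ≥0) < x := by simpa using hx
    simpa using hx'.le
  have h := (mul_le_mul_right (measure_mono hsub) (n : ℝ≥0∞)).trans (hmarkov.trans (hν n))
  exact (ENNReal.mul_le_mul_iff_right hn0 (ENNReal.natCast_ne_top n)).1 (h.trans hn.le)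

lemma hasFiniteMean_of_mem_statesOfMeanLE {m : ℝ≥0} {ν : ProbabilityMeasure ℝ≥0}
    (hν : ν ∈ statesOfMeanLE m) : HasFiniteMean ν := by
  have hle : ∫⁻ x, (x : ℝ≥0∞) ∂(ν : Measure ℝ≥0) ≤ m := by
    have hsup : ∀ x : ℝ≥0, (x : ℝ≥0∞) ≤ ⨆ n : ℕ, ((min x (n : ℝ≥0) : ℝ≥0) : ℝ≥0∞) := by
      intro x
      obtain ⟨n, hn⟩ := exists_nat_ge x
      exact le_iSup_of_le n (by rw [min_eq_left hn])
    refine (lintegral_mono hsup).trans ?_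
    rw [lintegral_iSup (fun n => by fun_prop)]
    · exact iSup_le hν
    · intro i j hij x
      have : (i : ℝ≥0) ≤ j := by exact_mod_cast hij
      exact ENNReal.coe_le_coe.2 (min_le_min_left _ this)
  refine ⟨by fun_prop, ?_⟩
  rw [hasFiniteIntegral_iff_enorm]
  refine lt_of_le_of_lt ?_ (hle.trans_lt ENNReal.coe_lt_top)
  exact lintegral_mono fun x => by simp [enorm_eq_nnnorm]

lemma mem_statesOfMeanLE {m : ℝ≥0} {ν : ProbabilityMeasure ℝ≥0} (hν : HasFiniteMean ν)
    (hm : meanWealth ν ≤ m) : ν ∈ statesOfMeanLE m := by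
  intro n
  have h : ENNReal.ofReal (meanWealth ν) = ∫⁻ x, (x : ℝ≥0∞) ∂(ν : Measure ℝ≥0) := by
    rw [meanWealth, ofReal_integral_eq_lintegral_ofReal hν (.of_forall fun x => x.coe_nonneg)]
    simp
  calc ∫⁻ x, (min x (n : ℝ≥0) : ℝ≥0) ∂(ν : Measure ℝ≥0)
      ≤ ∫⁻ x, (x : ℝ≥0∞) ∂(ν : Measure ℝ≥0) :=
        lintegral_mono fun x => ENNReal.coe_le_coe.2 (min_le_left _ _)
    _ ≤ m := by
        rw [← h]
        exact ENNReal.ofReal_le_of_le_toReal (by simpa using hm)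

/-! ### The Lyapunov functional -/

/-- The Lyapunov functional `∫ exp (-x) dν`; it equals `1` only when all agents have wealth `0`. -/
noncomputable def expMean (ν : ProbabilityMeasure ℝ≥0) : ℝ :=
  ∫ x, Real.exp (-(x : ℝ)) ∂(ν : Measure ℝ≥0)

lemma exp_neg_le_one (x : ℝ≥0) : Real.exp (-(x : ℝ)) ≤ 1 :=
  Real.exp_le_one_iff.2 (by simp)

lemma integrable_exp_neg (ν : ProbabilityMeasure ℝ≥0) :
    Integrable (fun x : ℝ≥0 => Real.exp (-(x : ℝ))) (ν : Measure ℝ≥0) :=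
  Integrable.of_bound (by fun_prop) 1 (.of_forall fun x => by
    rw [Real.norm_eq_abs, abs_of_pos (Real.exp_pos _)]
    exact exp_neg_le_one x)

lemma expMean_le_one (ν : ProbabilityMeasure ℝ≥0) : expMean ν ≤ 1 := by
  have h := integral_mono (integrable_exp_neg ν) (integrable_const 1) exp_neg_le_one
  rwa [integral_const, probReal_univ, one_smul] at h

lemma expMean_nonneg (ν : ProbabilityMeasure ℝ≥0) : 0 ≤ expMean ν :=
  integral_nonneg fun _ => (Real.exp_pos _).le

lemma continuous_expMean : Continuous expMean :=
  ProbabilityMeasure.continuous_integral_boundedContinuousFunction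
    (BoundedContinuousFunction.ofNormedAddCommGroup (fun x : ℝ≥0 => Real.exp (-(x : ℝ)))
      (by fun_prop) 1 (fun x => by
        rw [Real.norm_eq_abs, abs_of_pos (Real.exp_pos _)]
        exact exp_neg_le_one x))

lemma expMean_eq_one {ν : ProbabilityMeasure ℝ≥0} (h : ∀ᵐ x ∂(ν : Measure ℝ≥0), x = 0) :
    expMean ν = 1 := by
  have h1 : (fun x : ℝ≥0 => Real.exp (-(x : ℝ))) =ᵐ[(ν : Measure ℝ≥0)] fun _ => 1 := by
    filter_upwards [h] with x hx
    simp [hx]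
  rw [expMean, integral_congr_ae h1]
  simp

lemma hasDerivWithinAt_expMean (hK : KeepsWealthNonneg K) (hcont : IsContinuousRule K)
    (hunb : IsUnbiased K) {μ : ℝ → ProbabilityMeasure ℝ≥0} (hμ : SolvesMasterEquation K μ)
    {t : ℝ} (ht : 0 ≤ t) :
    HasDerivWithinAt (fun s => expMean (μ s)) (dissipation K (μ t)) (Set.Ici 0) t := by
  -- Test functions are bounded on all of `ℝ`, hence the positive part.
  let φ : ℝ →ᵇ ℝ := BoundedContinuousFunction.ofNormedAddCommGroup
    (fun y => Real.exp (-max y 0)) (by fun_prop) 1 (fun y => by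
      rw [Real.norm_eq_abs, abs_of_pos (Real.exp_pos _)]
      exact Real.exp_le_one_iff.2 (by simp))
  have hφ : ∀ y : ℝ, 0 ≤ y → φ y = Real.exp (-y) := fun y hy => by
    change Real.exp (-max y 0) = _
    rw [max_eq_left hy]
  have hinc : ∀ x x' : ℝ≥0,
      ∫ Δ, (φ ((x : ℝ) + Δ) - φ (x : ℝ)) ∂(K (x, x')) = expIncrement K (x, x') := by
    intro x x'
    have h : (fun Δ : ℝ => φ ((x : ℝ) + Δ) - φ (x : ℝ)) =ᵐ[K (x, x')]
        fun Δ => Real.exp (-(x : ℝ)) * (Real.exp (-Δ) - 1) := by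
      filter_upwards [hK x x'] with Δ hΔ
      rw [hφ _ (by linarith [hΔ.1]), hφ _ x.coe_nonneg, neg_add, Real.exp_add]
      ring
    rw [integral_congr_ae h, integral_const_mul,
      integral_sub (hK.integrable_exp_neg_gain _) (integrable_const _), expIncrement]
    simp
  have h := hμ φ t ht
  simp only [hinc] at h
  rw [dissipation, integral_prod _ (integrable_expIncrement hK hcont hunb _)]
  simpa only [expMean, hφ _ (NNReal.coe_nonneg _)] using h

/-- Away from the point mass at `0` the dissipation is bounded below, by compactness. As the
Lyapunov functional is bounded by `1`, it cannot stay away from its maximum. -/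
lemma tendsto_expMean (hK : KeepsWealthNonneg K) (hcont : IsContinuousRule K)
    (hunb : IsUnbiased K) (habs : ZeroIsUniqueAbsorbing K) {m : ℝ≥0}
    {μ : ℝ → ProbabilityMeasure ℝ≥0} (hμ : IsEvolution K (m : ℝ) μ) :
    Tendsto (fun t => expMean (μ t)) atTop (𝓝 1) := by
  set E : ℝ → ℝ := fun t => expMean (μ t) with hE
  have hder : ∀ t, 0 ≤ t → HasDerivWithinAt E (dissipation K (μ t)) (Set.Ici 0) t :=
    fun t ht => hasDerivWithinAt_expMean hK hcont hunb hμ.master ht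
  have hEcont : ContinuousOn E (Set.Ici 0) := fun t ht => (hder t ht).continuousWithinAt
  have hEder : ∀ t ∈ interior (Set.Ici (0 : ℝ)), HasDerivAt E (dissipation K (μ t)) t := by
    intro t ht
    rw [interior_Ici] at ht
    exact (hder t (le_of_lt ht)).hasDerivAt (Ici_mem_nhds ht)
  have growth : ∀ c : ℝ, (∀ t, 0 ≤ t → c ≤ dissipation K (μ t)) →
      ∀ s t, 0 ≤ s → s ≤ t → c * (t - s) ≤ E t - E s := by
    intro c hc s t hs hst
    refine (convex_Ici (0 : ℝ)).mul_sub_le_image_sub_of_le_deriv hEcont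
      (fun u hu => (hEder u hu).differentiableAt.differentiableWithinAt) ?_ s hs t
      (hs.trans hst) hst
    intro u hu
    rw [(hEder u hu).deriv]
    exact hc u (interior_subset hu)
  have hmono : ∀ s t, 0 ≤ s → s ≤ t → E s ≤ E t := fun s t hs hst => by
    have := growth 0 (fun u _ => dissipation_nonneg hK hunb _) s t hs hst
    linarith
  rw [Metric.tendsto_atTop]
  intro ε hε
  suffices h : ∃ T, 0 ≤ T ∧ 1 - ε < E T by
    obtain ⟨T, hT0, hT⟩ := h
    refine ⟨T, fun t ht => ?_⟩
    have h1 := hmono T t hT0 ht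
    have h2 : E t ≤ 1 := expMean_le_one _
    rw [Real.dist_eq, abs_lt]
    constructor <;> linarith
  by_contra! hfar
  have hS : IsCompact (statesOfMeanLE m ∩ {ν | expMean ν ≤ 1 - ε}) :=
    (isCompact_statesOfMeanLE m).inter_right (isClosed_le continuous_expMean continuous_const)
  have hmem : ∀ t, 0 ≤ t → μ t ∈ statesOfMeanLE m ∩ {ν | expMean ν ≤ 1 - ε} := fun t ht =>
    ⟨mem_statesOfMeanLE (hμ.finite_mean t ht) (hμ.mean_eq t ht).le, hfar t ht⟩
  obtain ⟨ν, ⟨hν, hνE⟩, hmin⟩ := hS.exists_isMinOn ⟨μ 0, hmem 0 le_rfl⟩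
    (continuous_dissipation hK hcont hunb).continuousOn
  have hpos : 0 < dissipation K ν := by
    refine (dissipation_nonneg hK hunb ν).lt_of_ne' fun h0 => ?_
    have := expMean_eq_one (ae_eq_zero_of_dissipation_eq_zero hK hcont hunb habs
      (hasFiniteMean_of_mem_statesOfMeanLE hν) h0)
    have hνE' : expMean ν ≤ 1 - ε := hνE
    linarith
  have hT : 0 ≤ 2 / dissipation K ν := by positivity
  have h := growth (dissipation K ν) (fun t ht => hmin (hmem t ht)) 0 _ le_rfl hT
  rw [sub_zero, mul_div_cancel₀ _ hpos.ne'] at h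
  have h1 : E (2 / dissipation K ν) ≤ 1 := expMean_le_one _
  have h2 : 0 ≤ E 0 := expMean_nonneg _
  linarith

/-! ### From the Lyapunov functional to the absolute oligarchy -/

/-- A continuous function vanishing at `0` and sublinear at infinity is dominated by the wealth, up
to a small factor, and the Lyapunov density `1 - exp (-x)`. -/
lemma exists_abs_le_of_sublinear {r : ℝ≥0 → ℝ} (hr : Continuous r) (h0 : r 0 = 0)
    (hlim : Tendsto (fun x : ℝ≥0 => r x / (x : ℝ)) atTop (𝓝 0)) {ε : ℝ} (hε : 0 < ε) :
    ∃ C : ℝ, 0 ≤ C ∧ ∀ x : ℝ≥0, |r x| ≤ ε * (1 + x) + C * (1 - Real.exp (-(x : ℝ))) := by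
  obtain ⟨δ, hδ, hsmall⟩ := Metric.continuous_iff.1 hr 0 ε hε
  obtain ⟨R, hR⟩ := Metric.tendsto_atTop.1 hlim ε hε
  obtain ⟨B, hB⟩ := (isCompact_Icc (a := (0 : ℝ≥0)) (b := R)).exists_bound_of_continuousOn
    hr.continuousOn
  have hB0 : 0 ≤ B := (norm_nonneg _).trans (hB 0 ⟨le_rfl, zero_le⟩)
  have hd : 0 < 1 - Real.exp (-δ) := sub_pos.2 (by simpa using hδ)
  refine ⟨B / (1 - Real.exp (-δ)), by positivity, fun x => ?_⟩
  have hx := x.coe_nonneg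
  have hex : 0 ≤ 1 - Real.exp (-(x : ℝ)) := sub_nonneg.2 (exp_neg_le_one x)
  rcases lt_or_ge (x : ℝ) δ with hxδ | hxδ
  · have h := hsmall x (by simpa [NNReal.dist_eq] using hxδ)
    rw [h0, dist_zero_right, Real.norm_eq_abs] at h
    have : 0 ≤ ε * x := by positivity
    have : 0 ≤ B / (1 - Real.exp (-δ)) * (1 - Real.exp (-(x : ℝ))) := by positivity
    linarith
  rcases le_total x R with hxR | hxR
  · have h : |r x| ≤ B := hB x ⟨zero_le, hxR⟩
    have h1 : B ≤ B / (1 - Real.exp (-δ)) * (1 - Real.exp (-(x : ℝ))) := by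
      rw [div_mul_eq_mul_div, le_div_iff₀ hd]
      gcongr
    have : 0 ≤ ε * (1 + x) := by positivity
    linarith
  · have hx0 : (0 : ℝ) < x := hδ.trans_le hxδ
    have h := hR x hxR
    rw [dist_zero_right, Real.norm_eq_abs, abs_div, abs_of_pos hx0, div_lt_iff₀ hx0] at h
    have : 0 ≤ B / (1 - Real.exp (-δ)) * (1 - Real.exp (-(x : ℝ))) := by positivity
    linarith

section Limit

variable {m : ℝ≥0} {μ : ℝ → ProbabilityMeasure ℝ≥0}

lemma tendsto_integral_of_sublinear (hfin : ∀ t, 0 ≤ t → HasFiniteMean (μ t))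
    (hmean : ∀ t, 0 ≤ t → meanWealth (μ t) = m)
    (hE : Tendsto (fun t => expMean (μ t)) atTop (𝓝 1)) {r : ℝ≥0 → ℝ} (hr : Continuous r)
    (h0 : r 0 = 0) (hlim : Tendsto (fun x : ℝ≥0 => r x / (x : ℝ)) atTop (𝓝 0)) :
    (∀ t, 0 ≤ t → Integrable r (μ t : Measure ℝ≥0)) ∧
      Tendsto (fun t => ∫ x, r x ∂(μ t : Measure ℝ≥0)) atTop (𝓝 0) := by
  have hdom : ∀ (ε C t : ℝ), 0 ≤ t →
      Integrable (fun x : ℝ≥0 => ε * (1 + (x : ℝ)) + C * (1 - Real.exp (-(x : ℝ))))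
        (μ t : Measure ℝ≥0) := fun ε C t ht =>
    (((integrable_const _).add (hfin t ht)).const_mul ε).add
      (((integrable_const _).sub (integrable_exp_neg (μ t))).const_mul C)
  have hdomval : ∀ (ε C t : ℝ), 0 ≤ t →
      ∫ x : ℝ≥0, (ε * (1 + (x : ℝ)) + C * (1 - Real.exp (-(x : ℝ)))) ∂(μ t : Measure ℝ≥0) =
        ε * (1 + m) + C * (1 - expMean (μ t)) := by
    intro ε C t ht
    have hx : Integrable (fun x : ℝ≥0 => (x : ℝ)) (μ t : Measure ℝ≥0) := hfin t ht
    have he := integrable_exp_neg (μ t)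
    have hone := integrable_const (μ := (μ t : Measure ℝ≥0)) (1 : ℝ)
    have hm' := hmean t ht
    rw [meanWealth] at hm'
    have h1 : Integrable (fun x : ℝ≥0 => ε * (1 + (x : ℝ))) (μ t : Measure ℝ≥0) :=
      (hone.add hx).const_mul ε
    have h2 : Integrable (fun x : ℝ≥0 => C * (1 - Real.exp (-(x : ℝ)))) (μ t : Measure ℝ≥0) :=
      (hone.sub he).const_mul C
    rw [integral_add h1 h2, integral_const_mul, integral_const_mul, integral_add hone hx,
      integral_sub hone he, hm', expMean]
    simp
  constructor
  · intro t ht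
    obtain ⟨C, -, hC⟩ := exists_abs_le_of_sublinear hr h0 hlim one_pos
    exact (hdom 1 C t ht).mono' hr.aestronglyMeasurable (.of_forall hC)
  · rw [Metric.tendsto_nhds]
    intro η hη
    have hm1 : (0 : ℝ) < 1 + m := by positivity
    obtain ⟨C, hC0, hC⟩ := exists_abs_le_of_sublinear hr h0 hlim
      (ε := η / 2 / (1 + m)) (by positivity)
    have hlimC : Tendsto (fun t => C * (1 - expMean (μ t))) atTop (𝓝 0) := by
      have := (tendsto_const_nhds (x := (1 : ℝ))).sub hE |>.const_mul C
      simpa using this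
    filter_upwards [eventually_ge_atTop 0, hlimC.eventually_lt_const (half_pos hη)] with t ht hlt
    have h := norm_integral_le_of_norm_le (f := r) (hdom (η / 2 / (1 + m)) C t ht) (.of_forall hC)
    rw [hdomval _ _ _ ht, div_mul_cancel₀ _ hm1.ne'] at h
    rw [dist_zero_right]
    linarith

lemma tendsto_integral_of_asymptotically_linear (hfin : ∀ t, 0 ≤ t → HasFiniteMean (μ t))
    (hmean : ∀ t, 0 ≤ t → meanWealth (μ t) = m)
    (hE : Tendsto (fun t => expMean (μ t)) atTop (𝓝 1)) {φ : ℝ≥0 → ℝ} (hφ : Continuous φ)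
    {c : ℝ} (hlim : Tendsto (fun x : ℝ≥0 => φ x / (x : ℝ)) atTop (𝓝 c)) :
    Tendsto (fun t => ∫ x, φ x ∂(μ t : Measure ℝ≥0)) atTop (𝓝 (φ 0 + c * m)) := by
  have hcoe : Tendsto (fun x : ℝ≥0 => (x : ℝ)) atTop atTop := NNReal.tendsto_coe_atTop.2 tendsto_id
  have hrlim : Tendsto (fun x : ℝ≥0 => (φ x - (φ 0 + c * x)) / (x : ℝ)) atTop (𝓝 0) := by
    have h := (hlim.sub (hcoe.const_div_atTop (φ 0))).sub_const c
    rw [sub_zero, sub_self] at h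
    refine h.congr' ?_
    filter_upwards [eventually_gt_atTop 0] with x hx
    have : (x : ℝ) ≠ 0 := by exact_mod_cast hx.ne'
    field_simp
    ring
  obtain ⟨hint, hlim0⟩ := tendsto_integral_of_sublinear hfin hmean hE
    (r := fun x => φ x - (φ 0 + c * x)) (by fun_prop) (by simp) hrlim
  have h := hlim0.add_const (φ 0 + c * m)
  rw [zero_add] at h
  refine h.congr' ?_
  filter_upwards [eventually_ge_atTop 0] with t ht
  have hx : Integrable (fun x : ℝ≥0 => (x : ℝ)) (μ t : Measure ℝ≥0) := hfin t ht
  have hlin : Integrable (fun x : ℝ≥0 => φ 0 + c * (x : ℝ)) (μ t : Measure ℝ≥0) :=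
    (integrable_const _).add (hx.const_mul c)
  have hval : ∫ x : ℝ≥0, (φ 0 + c * (x : ℝ)) ∂(μ t : Measure ℝ≥0) = φ 0 + c * m := by
    have hm' := hmean t ht
    rw [meanWealth] at hm'
    rw [integral_add (integrable_const _) (hx.const_mul c), integral_const_mul, hm']
    simp
  rw [← hval, ← integral_add (hint t ht) hlin]
  simp

lemma tendsto_div_atTop_of_bounded {φ : ℝ≥0 → ℝ} {C : ℝ} (hC : ∀ x, |φ x| ≤ C) :
    Tendsto (fun x : ℝ≥0 => φ x / (x : ℝ)) atTop (𝓝 0) := by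
  have hcoe : Tendsto (fun x : ℝ≥0 => (x : ℝ)) atTop atTop := NNReal.tendsto_coe_atTop.2 tendsto_id
  refine squeeze_zero_norm (fun x => ?_) (hcoe.const_div_atTop C)
  rw [norm_div, Real.norm_eq_abs, Real.norm_eq_abs, abs_of_nonneg x.coe_nonneg]
  gcongr
  exact hC x

lemma tendsto_integral_min (hfin : ∀ t, 0 ≤ t → HasFiniteMean (μ t))
    (hmean : ∀ t, 0 ≤ t → meanWealth (μ t) = m)
    (hE : Tendsto (fun t => expMean (μ t)) atTop (𝓝 1)) (R : ℝ≥0) :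
    Tendsto (fun t => ∫ x : ℝ≥0, min (x : ℝ) R ∂(μ t : Measure ℝ≥0)) atTop (𝓝 0) := by
  have h := tendsto_integral_of_asymptotically_linear hfin hmean hE
    (φ := fun x => min (x : ℝ) R) (by fun_prop) (c := 0)
    (tendsto_div_atTop_of_bounded (C := R) fun x => by
      rw [abs_of_nonneg (le_min x.coe_nonneg R.coe_nonneg)]
      exact min_le_right _ _)
  simpa using h

lemma integrable_min {ν : ProbabilityMeasure ℝ≥0} (R : ℝ≥0) :
    Integrable (fun x : ℝ≥0 => min (x : ℝ) R) (ν : Measure ℝ≥0) :=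
  Integrable.of_bound (by fun_prop) (R : ℝ) (.of_forall fun x => by
    rw [Real.norm_eq_abs, abs_of_nonneg (le_min x.coe_nonneg R.coe_nonneg)]
    exact min_le_right _ _)

lemma tendsto_setIntegral_Ioi (hfin : ∀ t, 0 ≤ t → HasFiniteMean (μ t))
    (hmean : ∀ t, 0 ≤ t → meanWealth (μ t) = m)
    (hE : Tendsto (fun t => expMean (μ t)) atTop (𝓝 1)) (R : ℝ≥0) :
    Tendsto (fun t : ℝ => ∫ x in Set.Ioi R, (x : ℝ) ∂(μ t : Measure ℝ≥0)) atTop (𝓝 (m : ℝ)) := by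
  have hlow := (tendsto_const_nhds (x := (m : ℝ))).sub (tendsto_integral_min hfin hmean hE R)
  rw [sub_zero] at hlow
  refine tendsto_of_tendsto_of_tendsto_of_le_of_le' hlow tendsto_const_nhds ?_ ?_
  · filter_upwards [eventually_ge_atTop 0] with t ht
    have hx : Integrable (fun x : ℝ≥0 => (x : ℝ)) (μ t : Measure ℝ≥0) := hfin t ht
    have hm' := hmean t ht
    rw [meanWealth] at hm'
    rw [← hm', ← integral_sub hx (integrable_min R), ← integral_indicator measurableSet_Ioi]
    refine integral_mono (hx.sub (integrable_min R)) (hx.indicator measurableSet_Ioi) fun x => ?_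
    by_cases hxR : x ∈ Set.Ioi R
    · simp [Set.indicator_of_mem hxR]
    · have hxR' : (x : ℝ) ≤ R := by simpa using hxR
      simp [Set.indicator_of_notMem hxR, min_eq_left hxR']
  · filter_upwards [eventually_ge_atTop 0] with t ht
    rw [← hmean t ht]
    exact setIntegral_le_integral (hfin t ht) (.of_forall fun x => x.coe_nonneg)

lemma tendsto_moment (hm : 0 < m) (hfin : ∀ t, 0 ≤ t → HasFiniteMean (μ t))
    (hescape : ∀ R : ℝ≥0, Tendsto (fun t : ℝ => ∫ x in Set.Ioi R, (x : ℝ) ∂(μ t : Measure ℝ≥0))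
      atTop (𝓝 (m : ℝ))) {k : ℝ} (hk : 1 < k) :
    Tendsto (fun t : ℝ => ∫⁻ x, (x : ℝ≥0∞) ^ k ∂(μ t : Measure ℝ≥0)) atTop (𝓝 ⊤) := by
  rw [ENNReal.tendsto_nhds_top_iff_nnreal]
  intro A
  have hk1 : 0 < k - 1 := by linarith
  -- `R` is chosen so that `R ^ (k - 1) * (m / 2) > A`.
  obtain ⟨R, hR⟩ : ∃ R : ℝ≥0, A < R ^ (k - 1) * (m / 2) := by
    refine ⟨((A + 1) / (m / 2)) ^ (1 / (k - 1)), ?_⟩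
    rw [← NNReal.rpow_mul, one_div_mul_cancel hk1.ne', NNReal.rpow_one,
      div_mul_cancel₀ _ (by positivity)]
    exact lt_add_one A
  have hm2 : ((m / 2 : ℝ≥0) : ℝ) < m := by
    rw [NNReal.coe_lt_coe]
    exact NNReal.half_lt_self hm.ne'
  filter_upwards [eventually_ge_atTop 0, (hescape R).eventually_const_lt hm2] with t ht hlt
  have hx : Integrable (fun x : ℝ≥0 => (x : ℝ)) (μ t : Measure ℝ≥0) := hfin t ht
  have hlow : ((m / 2 : ℝ≥0) : ℝ≥0∞) ≤ ∫⁻ x in Set.Ioi R, (x : ℝ≥0∞) ∂(μ t : Measure ℝ≥0) := by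
    have h : ENNReal.ofReal (∫ x in Set.Ioi R, (x : ℝ) ∂(μ t : Measure ℝ≥0)) =
        ∫⁻ x in Set.Ioi R, (x : ℝ≥0∞) ∂(μ t : Measure ℝ≥0) := by
      rw [ofReal_integral_eq_lintegral_ofReal hx.integrableOn (.of_forall fun x => x.coe_nonneg)]
      simp
    rw [← h, ← ENNReal.ofReal_coe_nnreal]
    exact ENNReal.ofReal_le_ofReal hlt.le
  calc (A : ℝ≥0∞) < ((R ^ (k - 1) * (m / 2) : ℝ≥0) : ℝ≥0∞) := ENNReal.coe_lt_coe.2 hR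
    _ = (R ^ (k - 1) : ℝ≥0) * ((m / 2 : ℝ≥0) : ℝ≥0∞) := ENNReal.coe_mul _ _
    _ ≤ (R ^ (k - 1) : ℝ≥0) * ∫⁻ x in Set.Ioi R, (x : ℝ≥0∞) ∂(μ t : Measure ℝ≥0) := by gcongr
    _ = ∫⁻ x in Set.Ioi R, (R ^ (k - 1) : ℝ≥0) * (x : ℝ≥0∞) ∂(μ t : Measure ℝ≥0) := by
        rw [lintegral_const_mul _ (by fun_prop)]
    _ ≤ ∫⁻ x in Set.Ioi R, (x : ℝ≥0∞) ^ k ∂(μ t : Measure ℝ≥0) := by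
        refine setLIntegral_mono (by fun_prop) fun x hxR => ?_
        have hx0 : x ≠ 0 := (zero_le.trans_lt hxR).ne'
        rw [← ENNReal.coe_rpow_of_ne_zero hx0, ← ENNReal.coe_mul, ENNReal.coe_le_coe]
        calc R ^ (k - 1) * x ≤ x ^ (k - 1) * x := by
              gcongr
              exact le_of_lt hxR
          _ = x ^ k := by
              rw [← NNReal.rpow_add_one hx0, sub_add_cancel]
    _ ≤ ∫⁻ x, (x : ℝ≥0∞) ^ k ∂(μ t : Measure ℝ≥0) := setLIntegral_le_lintegral _ _

/-! ### Gini index and liquidity -/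

lemma integrable_min_prod {ν : ProbabilityMeasure ℝ≥0} (hν : HasFiniteMean ν) :
    Integrable (fun p : ℝ≥0 × ℝ≥0 => min (p.1 : ℝ) p.2)
      ((ν : Measure ℝ≥0).prod (ν : Measure ℝ≥0)) := by
  have hν' : Integrable (fun x : ℝ≥0 => (x : ℝ)) (ν : Measure ℝ≥0) := hν
  refine (hν'.comp_fst (ν : Measure ℝ≥0)).mono' (by fun_prop) (.of_forall fun p => ?_)
  rw [Real.norm_eq_abs, abs_of_nonneg (le_min p.1.coe_nonneg p.2.coe_nonneg)]
  exact min_le_left _ _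

/-- The estimate `min x y ≤ x * min y 1 + min x 1` reduces the double integral to the single
integral of `min x 1`, because the mean is bounded. -/
lemma tendsto_integral_min_prod (hfin : ∀ t, 0 ≤ t → HasFiniteMean (μ t))
    (hmean : ∀ t, 0 ≤ t → meanWealth (μ t) = m)
    (hE : Tendsto (fun t => expMean (μ t)) atTop (𝓝 1)) :
    Tendsto (fun t => ∫ p : ℝ≥0 × ℝ≥0, min (p.1 : ℝ) p.2
      ∂((μ t : Measure ℝ≥0).prod (μ t : Measure ℝ≥0))) atTop (𝓝 0) := by
  have hmin := tendsto_integral_min hfin hmean hE 1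
  have hup := (hmin.const_mul (m : ℝ)).add hmin
  rw [mul_zero, add_zero] at hup
  refine tendsto_of_tendsto_of_tendsto_of_le_of_le' tendsto_const_nhds hup
    (.of_forall fun t => integral_nonneg fun p => le_min p.1.coe_nonneg p.2.coe_nonneg) ?_
  filter_upwards [eventually_ge_atTop 0] with t ht
  have hx : Integrable (fun x : ℝ≥0 => (x : ℝ)) (μ t : Measure ℝ≥0) := hfin t ht
  have hm1 := integrable_min (ν := μ t) 1
  have hprod := hx.mul_prod hm1
  have hfst := hm1.comp_fst (μ t : Measure ℝ≥0)
  have hm' := hmean t ht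
  rw [meanWealth] at hm'
  calc ∫ p : ℝ≥0 × ℝ≥0, min (p.1 : ℝ) p.2 ∂((μ t : Measure ℝ≥0).prod (μ t : Measure ℝ≥0))
      ≤ ∫ p : ℝ≥0 × ℝ≥0, ((p.1 : ℝ) * min (p.2 : ℝ) (1 : ℝ≥0) + min (p.1 : ℝ) (1 : ℝ≥0))
          ∂((μ t : Measure ℝ≥0).prod (μ t : Measure ℝ≥0)) := by
        refine integral_mono (integrable_min_prod (hfin t ht)) (hprod.add hfst) fun p => ?_
        have h1 := p.1.coe_nonneg
        have h2 := p.2.coe_nonneg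
        simp only [NNReal.coe_one]
        rcases le_total (p.2 : ℝ) 1 with h | h
        · have := min_le_min_left (p.1 : ℝ) h
          rw [min_eq_left h]
          have := mul_nonneg h1 h2
          linarith
        · have := min_le_left (p.1 : ℝ) p.2
          have := le_min h1 zero_le_one
          rw [min_eq_right h]
          linarith
    _ = m * ∫ x : ℝ≥0, min (x : ℝ) (1 : ℝ≥0) ∂(μ t : Measure ℝ≥0) +
          ∫ x : ℝ≥0, min (x : ℝ) (1 : ℝ≥0) ∂(μ t : Measure ℝ≥0) := by
        rw [integral_add hprod hfst,
          integral_prod_mul (fun x : ℝ≥0 => (x : ℝ)) (fun y : ℝ≥0 => min (y : ℝ) (1 : ℝ≥0)), hm',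
          integral_fun_fst (fun x : ℝ≥0 => min (x : ℝ) (1 : ℝ≥0))]
        simp

lemma giniIndex_eq {ν : ProbabilityMeasure ℝ≥0} (hν : HasFiniteMean ν) (hpos : 0 < meanWealth ν) :
    giniIndex ν = 1 - (meanWealth ν)⁻¹ *
      ∫ p : ℝ≥0 × ℝ≥0, min (p.1 : ℝ) p.2 ∂((ν : Measure ℝ≥0).prod (ν : Measure ℝ≥0)) := by
  have hx : Integrable (fun x : ℝ≥0 => (x : ℝ)) (ν : Measure ℝ≥0) := hν
  have hfst := hx.comp_fst (ν : Measure ℝ≥0)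
  have hsnd := hx.comp_snd (ν : Measure ℝ≥0)
  have hmin := (integrable_min_prod hν).const_mul 2
  have habs : ∀ x y : ℝ≥0, |(x : ℝ) - y| = (x : ℝ) + y - 2 * min (x : ℝ) y := by
    intro x y
    rcases le_total (x : ℝ) y with h | h
    · rw [min_eq_left h, abs_of_nonpos (by linarith)]; ring
    · rw [min_eq_right h, abs_of_nonneg (by linarith)]; ring
  rw [giniIndex]
  simp only [habs]
  have hsum : Integrable (fun p : ℝ≥0 × ℝ≥0 => (p.1 : ℝ) + p.2)
      ((ν : Measure ℝ≥0).prod (ν : Measure ℝ≥0)) := hfst.add hsnd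
  rw [← integral_prod (fun p : ℝ≥0 × ℝ≥0 => (p.1 : ℝ) + p.2 - 2 * min (p.1 : ℝ) p.2)
    (hsum.sub hmin), integral_sub hsum hmin, integral_add hfst hsnd,
    integral_const_mul, integral_fun_fst (fun x : ℝ≥0 => (x : ℝ)),
    integral_fun_snd (fun x : ℝ≥0 => (x : ℝ)), probReal_univ, one_smul]
  change 1 / (2 * meanWealth ν) * (meanWealth ν + meanWealth ν - _) = _
  field_simp
  ring

lemma mobility_nonneg (K : Kernel (ℝ≥0 × ℝ≥0) ℝ) (ν : ProbabilityMeasure ℝ≥0) (x : ℝ≥0) :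
    0 ≤ mobility K ν x :=
  integral_nonneg fun _ => integral_nonneg fun _ => abs_nonneg _

lemma liquidity_nonneg (K : Kernel (ℝ≥0 × ℝ≥0) ℝ) (ν : ProbabilityMeasure ℝ≥0) :
    0 ≤ liquidity K ν := by
  have : 0 ≤ meanWealth ν := integral_nonneg fun x => x.coe_nonneg
  exact mul_nonneg (by positivity) (integral_nonneg fun x => mobility_nonneg K ν x)

lemma liquidity_le (hK : KeepsWealthNonneg K) (hunb : IsUnbiased K)
    {ν : ProbabilityMeasure ℝ≥0} (hν : HasFiniteMean ν) (hpos : 0 < meanWealth ν) :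
    liquidity K ν ≤ (meanWealth ν)⁻¹ *
      ∫ p : ℝ≥0 × ℝ≥0, min (p.1 : ℝ) p.2 ∂((ν : Measure ℝ≥0).prod (ν : Measure ℝ≥0)) := by
  have hmin := (integrable_min_prod hν).const_mul 2
  have hmob : ∀ x : ℝ≥0, mobility K ν x ≤ ∫ x' : ℝ≥0, 2 * min (x : ℝ) x' ∂(ν : Measure ℝ≥0) := by
    intro x
    refine integral_mono_of_nonneg (.of_forall fun _ => integral_nonneg fun _ => abs_nonneg _) ?_
      (.of_forall fun x' => integral_abs_gain_le hK hunb x x')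
    have := (integrable_min (ν := ν) x).const_mul 2
    simpa only [min_comm] using this
  have h : ∫ x, mobility K ν x ∂(ν : Measure ℝ≥0) ≤
      2 * ∫ p : ℝ≥0 × ℝ≥0, min (p.1 : ℝ) p.2 ∂((ν : Measure ℝ≥0).prod (ν : Measure ℝ≥0)) := by
    rw [← integral_const_mul, integral_prod _ hmin]
    exact integral_mono_of_nonneg (.of_forall fun x => mobility_nonneg K ν x)
      hmin.integral_prod_left (.of_forall hmob)
  calc liquidity K ν ≤ 1 / (2 * meanWealth ν) * (2 *
        ∫ p : ℝ≥0 × ℝ≥0, min (p.1 : ℝ) p.2 ∂((ν : Measure ℝ≥0).prod (ν : Measure ℝ≥0))) :=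
        mul_le_mul_of_nonneg_left h (by positivity)
    _ = _ := by field_simp

lemma tendstoToAbsoluteOligarchy_of_expMean (hm : 0 < m)
    (hfin : ∀ t, 0 ≤ t → HasFiniteMean (μ t)) (hmean : ∀ t, 0 ≤ t → meanWealth (μ t) = m)
    (hE : Tendsto (fun t => expMean (μ t)) atTop (𝓝 1)) : TendsToAbsoluteOligarchy m μ where
  tendsto_dirac := by
    refine ProbabilityMeasure.tendsto_iff_forall_integral_tendsto.2 fun f => ?_
    have h := tendsto_integral_of_asymptotically_linear hfin hmean hE f.continuous
      (tendsto_div_atTop_of_bounded (C := ‖f‖) fun x => f.norm_coe_le_norm x)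
    simpa using h
  tendsto_pairing := by
    intro φ hφ c v hc hv
    have hmN : Tendsto (fun N : ℕ => m * (N : ℝ≥0)) atTop atTop :=
      tendsto_natCast_atTop_atTop.const_mul_atTop hm
    have hv' : Tendsto (fun N : ℕ => φ 0 + φ (m * (N : ℝ≥0)) / (N : ℝ)) atTop
        (𝓝 (φ 0 + c * m)) := by
      refine (((hc.comp hmN).mul_const (m : ℝ)).const_add (φ 0)).congr fun N => ?_
      have : (m : ℝ) ≠ 0 := by exact_mod_cast hm.ne'
      simp only [Function.comp_apply, NNReal.coe_mul, NNReal.coe_natCast]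
      rw [mul_comm (m : ℝ), ← div_div, div_mul_cancel₀ _ this]
    rw [tendsto_nhds_unique hv hv']
    exact tendsto_integral_of_asymptotically_linear hfin hmean hE hφ hc
  wealth_escapes := tendsto_setIntegral_Ioi hfin hmean hE
  moments_diverge := fun _ hk => tendsto_moment hm hfin (tendsto_setIntegral_Ioi hfin hmean hE) hk

end Limit

theorem proposition3 (K : Kernel (ℝ≥0 × ℝ≥0) ℝ) [IsMarkovKernel K]
    (hK : KeepsWealthNonneg K) (hcont : IsContinuousRule K) (hunb : IsUnbiased K)
    (habs : ZeroIsUniqueAbsorbing K)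
    (m : ℝ≥0) (hm : 0 < m) (μ : ℝ → ProbabilityMeasure ℝ≥0) (hμ : IsEvolution K (m : ℝ) μ) :
    TendsToAbsoluteOligarchy m μ ∧
      Tendsto (fun t : ℝ => giniIndex (μ t)) atTop (𝓝 1) ∧
      Tendsto (fun t : ℝ => liquidity K (μ t)) atTop (𝓝 0) := by
  have hfin := hμ.finite_mean
  have hmean := hμ.mean_eq
  have hE := tendsto_expMean hK hcont hunb habs hμ
  have hpos : ∀ t, 0 ≤ t → 0 < meanWealth (μ t) := fun t ht => by
    rw [hmean t ht]
    exact_mod_cast hm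
  have hmin := (tendsto_integral_min_prod hfin hmean hE).const_mul (m : ℝ)⁻¹
  rw [mul_zero] at hmin
  refine ⟨tendstoToAbsoluteOligarchy_of_expMean hm hfin hmean hE, ?_, ?_⟩
  · have h := hmin.const_sub 1
    rw [sub_zero] at h
    refine h.congr' ?_
    filter_upwards [eventually_ge_atTop 0] with t ht
    rw [giniIndex_eq (hfin t ht) (hpos t ht), hmean t ht]
  · refine tendsto_of_tendsto_of_tendsto_of_le_of_le' tendsto_const_nhds hmin
      (.of_forall fun t => liquidity_nonneg K (μ t)) ?_
    filter_upwards [eventually_ge_atTop 0] with t ht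
    have h := liquidity_le hK hunb (hfin t ht) (hpos t ht)
    rwa [hmean t ht] at h
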